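/- Let $\mathcal W$ be the set of continuous nondecreasing functions $\omega:[0,\infty)\to[0,\infty)$ with $\omega(0)=0$, $\omega(t)>0$ for $t>0$, $\omega(x+y)\le\omega(x)+\omega(y)$, $\int_1^\infty \omega(t)t^{-2}\,dt<\infty$ and $\lim_{t\to\infty}\omega(t)/\log(1+t)=\infty$. For $\omega_1,\omega_2\in\mathcal W$ write $\omega_1\ll\omega_2$ if $\omega_1(t)=o(\omega_2(t))$ as $t\to\infty$. Let $\Omega\subseteq\mathbb R^d$ be open and $\omega\in\mathcal W$. For $l>0$ put $\|f\|_l^{\omega}=\int|\hat f(\xi)|e^{l\omega(|\xi|)}\,d\xi\in[0,\infty]$. Let $\mathcal D^{(\omega)}(\Omega)$ (Beurling), respectively $\mathcal D^{\{\omega\}}(\Omega)$ (Roumieu), be the set of smooth functions $f:\mathbb R^d\to\mathbb C$ with compact support in $\Omega$ such that $\|f\|_l^\omega<\infty$ for all $l>0$, respectively for some $l>0$. Let $\mathcal E^{\{\omega\}}(\Omega)$ be the set of smooth $f:\Omega\to\mathbb C$ with $\varphi f\in\mathcal D^{\{\omega\}}(\Omega)$ for all $\varphi\in\mathcal D^{\{\omega\}}(\Omega)$,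 and for compact $K\subset\Omega$ let $\|f\|_{K,l}^{\omega}$ be the infimum of $\|\varphi f\|_l^\omega$ over all $\varphi\in\mathcal D^{\{\omega\}}(\Omega)$ with $\varphi=1$ on $K$. A net $(g_\varepsilon)_{0<\varepsilon<1}$ in $\mathcal E^{\{\omega\}}(\Omega)$ is moderate if for every compact $K\subset\Omega$ and every $k>0$ there is $l>0$ with $\|g_\varepsilon\|_{K,l}^\omega=o(e^{k\omega(1/\varepsilon)})$ as $\varepsilon\to0^+$, and negligible if for every compact $K\subset\Omega$ there are $k,l>0$ with $\|g_\varepsilon\|_{K,l}^\omega=o(e^{-k\omega(1/\varepsilon)})$. Let $\mathcal G^{\{\omega\}}(\Omega)$ be the quotient of the space of moderate nets by the space of negligible nets. A net $(r_\varepsilon)$ of complex numbers is Roumieu-negligible if $|r_\varepsilon|=o(e^{-m\omega(1/\varepsilon)})$ for some $m>0$. **Theorem.** Let $h=[(h_\varepsilon)]\in\mathcal G^{\{\omega\}}(\Omega)$. Suppose that there is $\omega_1\in\mathcal W$ with $\omega_1\ll\omega$ such that for every $\rho\in\mathcal D^{(\omega_1)}(\Omega)$ the net $\langle h_\varepsilon,\rho\rangle=\int_\Omega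 h_\varepsilon(x)\rho(x)\,dx$ is Roumieu-negligible (with respect to $\omega$). Then $h=0$ in $\mathcal G^{\{\omega\}}(\Omega)$, i.e. $(h_\varepsilon)$ is negligible. -/

import Mathlib

open MeasureTheory Filter Topology Set
open scoped ENNReal FourierTransform Asymptotics

/-- The Euclidean space `ℝ^d`. -/
abbrev Eucl (d : ℕ) : Type := EuclideanSpace ℝ (Fin d)

/-- The class `𝓦` of weight functions on `ℝ⁺ = [0, ∞)`. Only the values of `ω` on `[0, ∞)` matter. -/
structure IsWeight (ω : ℝ → ℝ) : Prop where
  continuousOn : ContinuousOn ω (Ici 0)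
  monotoneOn : MonotoneOn ω (Ici 0)
  map_zero : ω 0 = 0
  pos : ∀ t, 0 < t → 0 < ω t
  subadditive : ∀ x y, 0 ≤ x → 0 ≤ y → ω (x + y) ≤ ω x + ω y
  integrable : IntegrableOn (fun t => ω t / t ^ 2) (Ioi 1)
  log_growth : Tendsto (fun t => ω t / Real.log (1 + t)) atTop atTop

/-- The strong inequality `ω₁ ≪ ω₂`: `ω₁(t) = o(ω₂(t))` as `t → ∞`. -/
def WeightLT (ω₁ ω₂ : ℝ → ℝ) : Prop := ω₁ =o[atTop] ω₂

/-- The norm `‖f‖_l^ω = ∫ |f̂(ξ)| e^{l ω(|ξ|)} dξ ∈ [0, ∞]`. -/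
noncomputable def weightNorm {d : ℕ} (ω : ℝ → ℝ) (l : ℝ) (f : Eucl d → ℂ) : ℝ≥0∞ :=
  ∫⁻ ξ, ‖𝓕 f ξ‖ₑ * ENNReal.ofReal (Real.exp (l * ω ‖ξ‖))

/-- The Beurling test functions `𝓓^{(ω)}(Ω)`. -/
def BeurlingTest {d : ℕ} (ω : ℝ → ℝ) (Ω : Set (Eucl d)) : Set (Eucl d → ℂ) :=
  {f | ContDiff ℝ (⊤ : ℕ∞) f ∧ HasCompactSupport f ∧ tsupport f ⊆ Ω ∧
    ∀ l : ℝ, 0 < l → weightNorm ω l f < ∞}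

/-- The Roumieu test functions `𝓓^{{ω}}(Ω)`. -/
def RoumieuTest {d : ℕ} (ω : ℝ → ℝ) (Ω : Set (Eucl d)) : Set (Eucl d → ℂ) :=
  {f | ContDiff ℝ (⊤ : ℕ∞) f ∧ HasCompactSupport f ∧ tsupport f ⊆ Ω ∧
    ∃ l : ℝ, 0 < l ∧ weightNorm ω l f < ∞}

/-- The Roumieu ultradifferentiable functions `𝓔^{{ω}}(Ω)`: smooth functions on `Ω` whose product
with every Roumieu test function is a Roumieu test function. A function on `Ω` is represented by
a total function, whose values outside `Ω` play no role. -/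
def RoumieuSmooth {d : ℕ} (ω : ℝ → ℝ) (Ω : Set (Eucl d)) : Set (Eucl d → ℂ) :=
  {f | ContDiffOn ℝ (⊤ : ℕ∞) f Ω ∧ ∀ φ ∈ RoumieuTest ω Ω, φ * f ∈ RoumieuTest ω Ω}

/-- The local norm `‖f‖_{K,l}^ω`: the infimum of `‖φ f‖_l^ω` over the Roumieu test functions `φ`
on `Ω` that take the value `1` on `K`. -/
noncomputable def localNorm {d : ℕ} (ω : ℝ → ℝ) (Ω K : Set (Eucl d)) (l : ℝ)
    (f : Eucl d → ℂ) : ℝ≥0∞ :=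
  ⨅ φ ∈ {φ | φ ∈ RoumieuTest ω Ω ∧ ∀ x ∈ K, φ x = 1}, weightNorm ω l (φ * f)

/-- `N(ε) = o(e^{k ω(1/ε)})` as `ε → 0⁺`, for a net `N` with values in `[0, ∞]`. -/
def IsLittleOExp (N : ℝ → ℝ≥0∞) (ω : ℝ → ℝ) (k : ℝ) : Prop :=
  Tendsto (fun ε => N ε * ENNReal.ofReal (Real.exp (-(k * ω (1 / ε))))) (𝓝[>] 0) (𝓝 0)

/-- Nets `(g_ε)` of functions; only the values for `0 < ε < 1` matter. -/
abbrev Net (d : ℕ) : Type := ℝ → Eucl d → ℂ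

/-- The Roumieu moderate nets `𝓔_M^{{ω}}(Ω)`. -/
def RoumieuModerate {d : ℕ} (ω : ℝ → ℝ) (Ω : Set (Eucl d)) : Set (Net d) :=
  {g | (∀ ε ∈ Ioo (0 : ℝ) 1, g ε ∈ RoumieuSmooth ω Ω) ∧
    ∀ K : Set (Eucl d), IsCompact K → K ⊆ Ω → ∀ k : ℝ, 0 < k → ∃ l : ℝ, 0 < l ∧
      IsLittleOExp (fun ε => localNorm ω Ω K l (g ε)) ω k}

/-- The Roumieu negligible nets `𝓝^{{ω}}(Ω)`. -/
def RoumieuNegligible {d : ℕ} (ω : ℝ → ℝ) (Ω : Set (Eucl d)) : Set (Net d) :=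
  {g | (∀ ε ∈ Ioo (0 : ℝ) 1, g ε ∈ RoumieuSmooth ω Ω) ∧
    ∀ K : Set (Eucl d), IsCompact K → K ⊆ Ω → ∃ k : ℝ, 0 < k ∧ ∃ l : ℝ, 0 < l ∧
      IsLittleOExp (fun ε => localNorm ω Ω K l (g ε)) ω (-k)}

/-- The class `[(g_ε)]` of a net modulo negligible nets, as a coset in the moderate nets. -/
def roumieuClass {d : ℕ} (ω : ℝ → ℝ) (Ω : Set (Eucl d)) (g : Net d) : Set (Net d) :=
  {g' | g' ∈ RoumieuModerate ω Ω ∧ g' - g ∈ RoumieuNegligible ω Ω}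

/-- The factor space `𝓖^{{ω}}(Ω) = 𝓔_M^{{ω}}(Ω) / 𝓝^{{ω}}(Ω)`, as the set of cosets. -/
def RoumieuG {d : ℕ} (ω : ℝ → ℝ) (Ω : Set (Eucl d)) : Set (Set (Net d)) :=
  {c | ∃ g ∈ RoumieuModerate ω Ω, c = roumieuClass ω Ω g}

/-- A Roumieu negligible net of constants: one that is `o(e^{-m ω(1/ε)})` for some `m > 0`, that is,
one whose class in the ring of Roumieu generalized constants is zero. -/
def NegligibleConst (ω : ℝ → ℝ) (r : ℝ → ℂ) : Prop :=
  ∃ m : ℝ, 0 < m ∧ IsLittleOExp (fun ε => ‖r ε‖ₑ) ω (-m)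

/-! ### Elementary estimates for weights -/

/-! Localize with a cutoff `χ` and put `W = √(ω₁ ω)`, a weight strictly between `ω₁` and `ω`. For
every `v ∈ L¹` the function `χ · 𝓕(e^{-W} v)` is a Beurling test function for `ω₁`, because `W`
beats every `l ω₁`. Its pairing with `h ε` equals `∫ 𝓕(χ h_ε) e^{-W} v`, so these functionals on
`L¹` decay like `e^{-m ω(1/ε)}` with `m` depending on `v`. Baire's theorem
(`exists_uniform_exp_decay`) makes `m` uniform.

Since every `c ω` beats `W`, testing against the phase of `𝓕(χ h_ε)` bounds the norm of each
negative order `-c` by `A e^{-m ω(1/ε)}`, with the same `m` for all `c`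
(`exists_weightNorm_neg_decay`). Moderateness at rate `m/2` then supplies a positive order `l` whose
norm grows at most like `e^{(m/2) ω(1/ε)}`. Interpolating between `l` and `-l/2` leaves a positive
order with exponential decay (`RoumieuModerate.isLittleOExp_weightNorm`). The uniformity of `m` is
essential: `l` depends on `m`, and `c = l/2` on `l`. -/

lemma exists_le_add_of_eventually_le {f g : ℝ → ℝ} (hf : MonotoneOn f (Ici 0))
    (hg : ∀ t, 0 ≤ t → 0 ≤ g t) (h : ∀ᶠ t in atTop, f t ≤ g t) :
    ∃ C, ∀ t, 0 ≤ t → f t ≤ g t + C := by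
  obtain ⟨T, hT⟩ := eventually_atTop.1 h
  refine ⟨|f (max T 0)|, fun t ht => ?_⟩
  have h0 := abs_nonneg (f (max T 0))
  rcases le_total (max T 0) t with h1 | h1
  · linarith [hT t (le_trans (le_max_left _ _) h1)]
  · linarith [hf (mem_Ici.2 ht) (mem_Ici.2 (le_max_right T 0)) h1, hg t ht,
      le_abs_self (f (max T 0))]

namespace IsWeight

variable {ω ω₁ : ℝ → ℝ}

lemma nonneg (hω : IsWeight ω) {t : ℝ} (ht : 0 ≤ t) : 0 ≤ ω t := by
  rcases ht.eq_or_lt with rfl | h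
  · exact hω.map_zero.ge
  · exact (hω.pos t h).le

lemma exists_mul_log_le (hω : IsWeight ω) {M : ℝ} (hM : 0 ≤ M) :
    ∃ C, ∀ t, 0 ≤ t → M * Real.log (1 + t) ≤ ω t + C := by
  refine exists_le_add_of_eventually_le ?_ (fun t ht => hω.nonneg ht) ?_
  · intro a ha b hb hab
    have ha' : (0 : ℝ) ≤ a := ha
    exact mul_le_mul_of_nonneg_left (Real.log_le_log (by linarith) (by linarith)) hM
  · filter_upwards [hω.log_growth.eventually_ge_atTop M, eventually_gt_atTop 0] with t h1 h2
    exact (le_div_iff₀ (Real.log_pos (by linarith))).1 h1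

lemma tendsto_atTop (hω : IsWeight ω) : Tendsto ω atTop atTop := by
  obtain ⟨C, hC⟩ := hω.exists_mul_log_le zero_le_one
  have h1 : Tendsto (fun t : ℝ => Real.log (1 + t) - C) atTop atTop :=
    tendsto_atTop_add_const_right _ _
      (Real.tendsto_log_atTop.comp (tendsto_atTop_add_const_left _ _ tendsto_id))
  refine tendsto_atTop_mono' _ ?_ h1
  filter_upwards [eventually_ge_atTop 0] with t ht
  linarith [hC t ht]

lemma tendsto_inv (hω : IsWeight ω) : Tendsto (fun ε => ω (1 / ε)) (𝓝[>] 0) atTop := by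
  simpa [Function.comp_def] using hω.tendsto_atTop.comp tendsto_inv_nhdsGT_zero

lemma exists_mul_le_mul (h₁ : IsWeight ω₁) (hω : IsWeight ω) (hlt : WeightLT ω₁ ω) {l c : ℝ}
    (hl : 0 ≤ l) (hc : 0 < c) : ∃ C, ∀ t, 0 ≤ t → l * ω₁ t ≤ c * ω t + C := by
  refine exists_le_add_of_eventually_le (fun a ha b hb hab =>
    mul_le_mul_of_nonneg_left (h₁.monotoneOn ha hb hab) hl)
    (fun t ht => mul_nonneg hc.le (hω.nonneg ht)) ?_
  -- Dividing by `l + 1` rather than `l` covers `l = 0`.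
  have hc' : 0 < c / (l + 1) := by positivity
  filter_upwards [hlt.def hc', eventually_ge_atTop 0] with t h1 h2
  rw [Real.norm_of_nonneg (h₁.nonneg h2), Real.norm_of_nonneg (hω.nonneg h2)] at h1
  calc l * ω₁ t ≤ (l + 1) * ω₁ t := by linarith [h₁.nonneg h2]
    _ ≤ (l + 1) * (c / (l + 1) * ω t) := by gcongr
    _ = c * ω t := by field_simp

/-- The geometric mean of two weights dominates every multiple of the smaller one. -/
lemma exists_mul_le_sqrt (h₁ : IsWeight ω₁) (hω : IsWeight ω) (hlt : WeightLT ω₁ ω) {l : ℝ}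
    (hl : 0 ≤ l) : ∃ C, ∀ t, 0 ≤ t → l * ω₁ t ≤ √(ω₁ t * ω t) + C := by
  refine exists_le_add_of_eventually_le (fun a ha b hb hab =>
    mul_le_mul_of_nonneg_left (h₁.monotoneOn ha hb hab) hl) (fun t _ => Real.sqrt_nonneg _) ?_
  -- Eventually `(l² + 1) ω₁ ≤ ω`; multiplying by `ω₁` gives `(l ω₁)² ≤ ω₁ ω`.
  have hc' : 0 < 1 / (l ^ 2 + 1) := by positivity
  filter_upwards [hlt.def hc', eventually_ge_atTop 0] with t h1 h2
  have h3 := h₁.nonneg h2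
  rw [Real.norm_of_nonneg h3, Real.norm_of_nonneg (hω.nonneg h2), one_div, inv_mul_eq_div,
    le_div_iff₀ (by positivity)] at h1
  apply Real.le_sqrt_of_sq_le
  nlinarith

/-- Every multiple of the larger weight dominates the geometric mean of two weights. -/
lemma exists_sqrt_le_mul (h₁ : IsWeight ω₁) (hω : IsWeight ω) (hlt : WeightLT ω₁ ω) {c : ℝ}
    (hc : 0 < c) : ∃ C, ∀ t, 0 ≤ t → √(ω₁ t * ω t) ≤ c * ω t + C := by
  -- This gives `ω₁ ≤ c (c ω + C)`, hence `ω₁ ω ≤ (c ω)² + C c ω ≤ (c ω + C)²` once `C ≥ 0`.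
  obtain ⟨C, hC⟩ := h₁.exists_mul_le_mul hω hlt (l := 1 / c) (by positivity) hc
  refine ⟨max C 0, fun t ht => ?_⟩
  have h1 := h₁.nonneg ht
  have h2 := hω.nonneg ht
  have h3 := hC t ht
  have h4 : ω₁ t ≤ c * (c * ω t + max C 0) := by
    have : ω₁ t = c * (1 / c * ω₁ t) := by field_simp
    rw [this]
    gcongr
    linarith [le_max_left C 0]
  have h5 : 0 ≤ max C 0 := le_max_right _ _
  apply Real.sqrt_le_iff.2 ⟨by positivity, ?_⟩
  have h6 : 0 ≤ c * ω t := by positivity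
  nlinarith [mul_le_mul_of_nonneg_right h4 h2]

lemma continuous_norm {d : ℕ} (hω : IsWeight ω) : Continuous fun ξ : Eucl d => ω ‖ξ‖ :=
  hω.continuousOn.comp_continuous _root_.continuous_norm fun ξ => norm_nonneg ξ

lemma continuous_exp_mul_norm {d : ℕ} (hω : IsWeight ω) (l : ℝ) :
    Continuous fun ξ : Eucl d => Real.exp (l * ω ‖ξ‖) :=
  Real.continuous_exp.comp (continuous_const.mul hω.continuous_norm)

lemma measurable_ofReal_exp {d : ℕ} (hω : IsWeight ω) (l : ℝ) :
    Measurable fun ξ : Eucl d => ENNReal.ofReal (Real.exp (l * ω ‖ξ‖)) :=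
  (hω.continuous_exp_mul_norm l).measurable.ennreal_ofReal

lemma norm_le_add {d : ℕ} (hω : IsWeight ω) (ξ η : Eucl d) : ω ‖ξ‖ ≤ ω ‖η + ξ‖ + ω ‖η‖ := by
  refine le_trans (hω.monotoneOn (norm_nonneg _) (mem_Ici.2 (by positivity)) ?_)
    (hω.subadditive _ _ (norm_nonneg _) (norm_nonneg _))
  simpa [add_comm] using norm_sub_le (η + ξ) η

lemma exists_norm_pow_le {d : ℕ} (hω : IsWeight ω) (n : ℕ) :
    ∃ C, ∀ ξ : Eucl d, ‖ξ‖ ^ n ≤ Real.exp C * Real.exp (ω ‖ξ‖) := by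
  obtain ⟨C, hC⟩ := hω.exists_mul_log_le (M := n) (Nat.cast_nonneg n)
  refine ⟨C, fun ξ => ?_⟩
  have h0 := norm_nonneg ξ
  calc ‖ξ‖ ^ n ≤ (1 + ‖ξ‖) ^ n := by gcongr; linarith
    _ = Real.exp (n * Real.log (1 + ‖ξ‖)) := by
      rw [mul_comm, Real.exp_mul, Real.exp_log (by positivity), Real.rpow_natCast]
    _ ≤ Real.exp (C + ω ‖ξ‖) := Real.exp_le_exp.2 (by linarith [hC _ h0])
    _ = _ := Real.exp_add _ _

lemma integrable_exp_neg {d : ℕ} (hω : IsWeight ω) {c : ℝ} (hc : 0 < c) :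
    Integrable fun ξ : Eucl d => Real.exp (-(c * ω ‖ξ‖)) := by
  obtain ⟨C, hC⟩ := hω.exists_mul_log_le (M := (d + 1) / c) (by positivity)
  have h1 : Integrable (fun ξ : Eucl d => (1 + ‖ξ‖) ^ (-(d + 1 : ℝ))) :=
    integrable_one_add_norm (by simp)
  refine (h1.const_mul (Real.exp (c * C))).mono'
    (by simpa using (hω.continuous_exp_mul_norm (-c)).aestronglyMeasurable) (ae_of_all _ fun ξ => ?_)
  have h0 := norm_nonneg ξ
  rw [Real.norm_of_nonneg (Real.exp_pos _).le, Real.rpow_def_of_pos (by positivity),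
    ← Real.exp_add]
  apply Real.exp_le_exp.2
  have := mul_le_mul_of_nonneg_left (hC _ h0) hc.le
  have h2 : c * ((d + 1) / c * Real.log (1 + ‖ξ‖)) = (d + 1) * Real.log (1 + ‖ξ‖) := by
    field_simp
  rw [h2] at this
  linarith

end IsWeight

/-! ### Fourier transforms of products -/

section Fourier

variable {d : ℕ} {ω : ℝ → ℝ}

lemma continuous_fourier {f : Eucl d → ℂ} (hf : Integrable f) : Continuous (𝓕 f) :=
  VectorFourier.fourierIntegral_continuous Real.continuous_fourierChar
    (by exact continuous_inner) hf

lemma integral_fourier_mul_eq {f g : Eucl d → ℂ} (hf : Integrable f) (hg : Integrable g) :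
    ∫ ξ, 𝓕 f ξ * g ξ = ∫ x, f x * 𝓕 g x := by
  simpa using! VectorFourier.integral_fourierIntegral_smul_eq_flip (L := innerₗ (Eucl d))
    Real.continuous_fourierChar continuous_inner hf hg

/-- Modulating `φ` translates its transform; the multiplication formula then moves `𝓕` from `u` to
the modulated `φ`. No inversion theorem is needed. -/
lemma fourier_mul_fourier_apply {φ u : Eucl d → ℂ} (hφ : Integrable φ) (hu : Integrable u)
    (ξ : Eucl d) : 𝓕 (φ * 𝓕 u) ξ = ∫ η, 𝓕 φ (η + ξ) * u η := by
  have hφ' : Integrable fun v => Real.fourierChar (-inner ℝ v ξ) • φ v :=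
    (Real.fourierIntegral_convergent_iff ξ).2 hφ
  have h1 : ∀ η, 𝓕 φ (η + ξ) = 𝓕 (fun v => Real.fourierChar (-inner ℝ v ξ) • φ v) η := by
    intro η
    simp only [Real.fourier_eq, inner_add_right, neg_add, AddChar.map_add_eq_mul, mul_smul]
  simp only [h1, integral_fourier_mul_eq hφ' hu]
  simp only [Real.fourier_eq (φ * 𝓕 u), Pi.mul_apply, smul_mul_assoc]

lemma weightNorm_mono (hω : IsWeight ω) {l l' : ℝ} (h : l ≤ l') (f : Eucl d → ℂ) :
    weightNorm ω l f ≤ weightNorm ω l' f := by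
  refine lintegral_mono fun ξ => ?_
  have := hω.nonneg (norm_nonneg ξ)
  gcongr

/-- Subadditivity makes `e^{l ω}` submultiplicative, so this is Young's `L¹` inequality with
weights: Tonelli and translation invariance. -/
lemma weightNorm_mul_fourier_le (hω : IsWeight ω) {l : ℝ} (hl : 0 ≤ l) {φ u : Eucl d → ℂ}
    (hφ : Integrable φ) (hu : Integrable u) :
    weightNorm ω l (φ * 𝓕 u) ≤
      weightNorm ω l φ * ∫⁻ η, ‖u η‖ₑ * ENNReal.ofReal (Real.exp (l * ω ‖η‖)) := by
  set e : Eucl d → ℝ≥0∞ := fun ξ => ENNReal.ofReal (Real.exp (l * ω ‖ξ‖)) with he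
  have hem : Measurable e := hω.measurable_ofReal_exp l
  have hee : ∀ ξ η, e ξ ≤ e (η + ξ) * e η := by
    intro ξ η
    simp only [he, ← ENNReal.ofReal_mul (Real.exp_pos _).le, ← Real.exp_add, ← mul_add]
    gcongr
    exact hω.norm_le_add ξ η
  have hFm : Measurable (𝓕 φ) := (continuous_fourier hφ).measurable
  have hum : AEMeasurable (fun η => ‖u η‖ₑ * e η) := hu.1.enorm.mul hem.aemeasurable
  calc weightNorm ω l (φ * 𝓕 u)
      ≤ ∫⁻ ξ, ∫⁻ η, (‖𝓕 φ (η + ξ)‖ₑ * e (η + ξ)) * (‖u η‖ₑ * e η) := by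
        refine lintegral_mono fun ξ => ?_
        rw [fourier_mul_fourier_apply hφ hu]
        calc _ ≤ (∫⁻ η, ‖𝓕 φ (η + ξ) * u η‖ₑ) * e ξ := by
              gcongr
              exact enorm_integral_le_lintegral_enorm _
          _ = ∫⁻ η, ‖𝓕 φ (η + ξ) * u η‖ₑ * e ξ :=
              (lintegral_mul_const' _ _ ENNReal.ofReal_ne_top).symm
          _ ≤ _ := by
              refine lintegral_mono fun η => ?_
              dsimp only
              rw [enorm_mul, mul_mul_mul_comm]
              gcongr
              exact hee ξ η
    _ = ∫⁻ η, ∫⁻ ξ, (‖𝓕 φ (η + ξ)‖ₑ * e (η + ξ)) * (‖u η‖ₑ * e η) := by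
        refine lintegral_lintegral_swap ?_
        have hm : Measurable fun p : Eucl d × Eucl d =>
            ‖𝓕 φ (p.2 + p.1)‖ₑ * e (p.2 + p.1) := by fun_prop
        exact hm.aemeasurable.mul <|
          hum.comp_quasiMeasurePreserving Measure.quasiMeasurePreserving_snd
    _ = ∫⁻ η, weightNorm ω l φ * (‖u η‖ₑ * e η) := by
        refine lintegral_congr fun η => ?_
        rw [lintegral_mul_const _ (by fun_prop),
          lintegral_add_left_eq_self (fun ξ => ‖𝓕 φ ξ‖ₑ * e ξ) η]
        rfl
    _ = _ := lintegral_const_mul'' _ hum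

lemma weightNorm_mul_le (hω : IsWeight ω) {l : ℝ} (hl : 0 ≤ l) {φ g : Eucl d → ℂ}
    (hφ : Integrable φ) (hgc : Continuous g) (hg : Integrable g) (hg' : Integrable (𝓕 g)) :
    weightNorm ω l (φ * g) ≤ weightNorm ω l φ * weightNorm ω l g := by
  have h1 : (𝓕⁻ g : Eucl d → ℂ) = fun ξ => 𝓕 g (-ξ) := funext (Real.fourierInv_eq_fourier_neg g)
  have h2 : Integrable (𝓕⁻ g : Eucl d → ℂ) := by
    rw [h1]; exact hg'.comp_neg
  have h3 := weightNorm_mul_fourier_le hω hl hφ h2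
  rw [hgc.fourier_fourierInv_eq hg hg'] at h3
  refine h3.trans_eq ?_
  congr 1
  rw [h1, weightNorm, ← lintegral_neg_eq_self]
  simp

lemma weightNorm_sub_le {f g : Eucl d → ℂ} (hf : Integrable f) (hg : Integrable g) (l : ℝ)
    (hω : IsWeight ω) : weightNorm ω l (f - g) ≤ weightNorm ω l f + weightNorm ω l g := by
  have hfc := continuous_fourier hf
  have h : 𝓕 (f - g) = 𝓕 f - 𝓕 g := by
    ext ξ
    simp only [Real.fourier_eq, Pi.sub_apply, smul_sub]
    exact integral_sub ((Real.fourierIntegral_convergent_iff ξ).2 hf)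
      ((Real.fourierIntegral_convergent_iff ξ).2 hg)
  rw [weightNorm, weightNorm, weightNorm, ← lintegral_add_left]
  · refine lintegral_mono fun ξ => ?_
    dsimp only
    rw [h, ← add_mul]
    gcongr
    exact enorm_sub_le
  · exact hfc.enorm.measurable.mul (hω.measurable_ofReal_exp l)

end Fourier

/-! ### Test functions and local norms -/

section TestFunctions

variable {d : ℕ} {ω : ℝ → ℝ} {Ω : Set (Eucl d)}

lemma RoumieuTest.integrable {f : Eucl d → ℂ} (hf : f ∈ RoumieuTest ω Ω) : Integrable f :=
  hf.1.continuous.integrable_of_hasCompactSupport hf.2.1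

lemma RoumieuTest.integrable_fourier (hω : IsWeight ω) {f : Eucl d → ℂ}
    (hf : f ∈ RoumieuTest ω Ω) : Integrable (𝓕 f) := by
  obtain ⟨l, hl, hfin⟩ := hf.2.2.2
  refine ⟨(continuous_fourier (RoumieuTest.integrable hf)).aestronglyMeasurable,
    lt_of_le_of_lt (lintegral_mono fun ξ => ?_) hfin⟩
  refine le_mul_of_one_le_right' ?_
  rw [ENNReal.one_le_ofReal, Real.one_le_exp_iff]
  exact mul_nonneg hl.le (hω.nonneg (norm_nonneg ξ))

lemma RoumieuTest.sub (hω : IsWeight ω) {f g : Eucl d → ℂ} (hf : f ∈ RoumieuTest ω Ω)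
    (hg : g ∈ RoumieuTest ω Ω) : f - g ∈ RoumieuTest ω Ω := by
  have hfi := RoumieuTest.integrable hf
  have hgi := RoumieuTest.integrable hg
  obtain ⟨hf1, hf2, hf3, l, hl, hf4⟩ := hf
  obtain ⟨hg1, hg2, hg3, l', hl', hg4⟩ := hg
  refine ⟨hf1.sub hg1, hf2.sub hg2, (tsupport_sub f g).trans (union_subset hf3 hg3),
    min l l', lt_min hl hl', ?_⟩
  refine (weightNorm_sub_le hfi hgi _ hω).trans_lt (ENNReal.add_lt_top.2 ⟨?_, ?_⟩)
  · exact (weightNorm_mono hω (min_le_left _ _) f).trans_lt hf4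
  · exact (weightNorm_mono hω (min_le_right _ _) g).trans_lt hg4

lemma RoumieuSmooth.sub (hω : IsWeight ω) {f g : Eucl d → ℂ} (hf : f ∈ RoumieuSmooth ω Ω)
    (hg : g ∈ RoumieuSmooth ω Ω) : f - g ∈ RoumieuSmooth ω Ω :=
  ⟨hf.1.sub hg.1, fun φ hφ => by
    rw [mul_sub]
    exact RoumieuTest.sub hω (hf.2 φ hφ) (hg.2 φ hφ)⟩

lemma localNorm_mono (hω : IsWeight ω) {l l' : ℝ} (h : l ≤ l') (K : Set (Eucl d))
    (f : Eucl d → ℂ) : localNorm ω Ω K l f ≤ localNorm ω Ω K l' f :=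
  iInf₂_mono fun _ _ => weightNorm_mono hω h _

lemma localNorm_le_weightNorm {K : Set (Eucl d)} {χ : Eucl d → ℂ} (hχ : χ ∈ RoumieuTest ω Ω)
    (hK : ∀ x ∈ K, χ x = 1) (l : ℝ) (f : Eucl d → ℂ) :
    localNorm ω Ω K l f ≤ weightNorm ω l (χ * f) :=
  iInf₂_le χ ⟨hχ, hK⟩

/-- Any `ψ` equal to `1` on the support of `χ` satisfies `χ f = χ (ψ f)`, so the product estimate
applies to each competitor in the infimum. The nonzero finite majorant `A` of the norm of `χ` can be
moved inside the infimum. -/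
lemma weightNorm_mul_le_localNorm (hω : IsWeight ω) {l : ℝ} (hl : 0 ≤ l) {χ f : Eucl d → ℂ}
    (hχ : χ ∈ RoumieuTest ω Ω) (hf : f ∈ RoumieuSmooth ω Ω) {A : ℝ≥0∞} (hA : A ≠ 0)
    (hA' : A ≠ ∞) (hχA : weightNorm ω l χ ≤ A) :
    weightNorm ω l (χ * f) ≤ A * localNorm ω Ω (tsupport χ) l f := by
  rw [localNorm, ENNReal.mul_iInf_of_ne hA hA']
  refine le_iInf fun ψ => ?_
  rw [ENNReal.mul_iInf_of_ne hA hA']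
  refine le_iInf fun hψ => ?_
  have hψf := hf.2 ψ hψ.1
  have h1 : χ * f = χ * (ψ * f) := by
    ext x
    by_cases hx : x ∈ tsupport χ
    · simp [hψ.2 x hx]
    · simp [image_eq_zero_of_notMem_tsupport hx]
  rw [h1]
  refine (weightNorm_mul_le hω hl (RoumieuTest.integrable hχ) hψf.1.continuous
    (RoumieuTest.integrable hψf) (RoumieuTest.integrable_fourier hω hψf)).trans ?_
  gcongr

lemma IsLittleOExp.mono {N N' : ℝ → ℝ≥0∞} {k k' : ℝ} (hω : IsWeight ω)
    (h : IsLittleOExp N ω k) (hN : ∀ᶠ ε in 𝓝[>] 0, N' ε ≤ N ε) (hk : k ≤ k') :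
    IsLittleOExp N' ω k' := by
  refine tendsto_of_tendsto_of_tendsto_of_le_of_le' tendsto_const_nhds h
    (Eventually.of_forall fun _ => zero_le) ?_
  filter_upwards [hN, self_mem_nhdsWithin] with ε h1 h2
  have h3 : 0 ≤ ω (1 / ε) := hω.nonneg (by have : (0 : ℝ) < ε := h2; positivity)
  gcongr

lemma IsLittleOExp.add {N N' : ℝ → ℝ≥0∞} {k : ℝ} (h : IsLittleOExp N ω k)
    (h' : IsLittleOExp N' ω k) : IsLittleOExp (fun ε => N ε + N' ε) ω k := by
  simpa [IsLittleOExp, add_mul] using! Tendsto.add h h'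

lemma IsLittleOExp.const_mul {N : ℝ → ℝ≥0∞} {k : ℝ} (h : IsLittleOExp N ω k) {A : ℝ≥0∞}
    (hA : A ≠ ∞) : IsLittleOExp (fun ε => A * N ε) ω k := by
  simpa [IsLittleOExp, mul_assoc] using! ENNReal.Tendsto.const_mul h (Or.inr hA)

lemma IsLittleOExp.eventually_le {N : ℝ → ℝ≥0∞} {k : ℝ} (h : IsLittleOExp N ω k) :
    ∀ᶠ ε in 𝓝[>] 0, N ε ≤ ENNReal.ofReal (Real.exp (k * ω (1 / ε))) := by
  filter_upwards [h.eventually_le_const zero_lt_one] with ε hε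
  calc N ε = N ε * ENNReal.ofReal (Real.exp (-(k * ω (1 / ε)))) *
        ENNReal.ofReal (Real.exp (k * ω (1 / ε))) := by
        rw [mul_assoc, ← ENNReal.ofReal_mul (Real.exp_pos _).le, ← Real.exp_add]
        simp
    _ ≤ 1 * _ := by gcongr
    _ = _ := one_mul _

lemma IsLittleOExp.of_eventually_le (hω : IsWeight ω) {N : ℝ → ℝ≥0∞} {k k' : ℝ} {A : ℝ≥0∞}
    (hA : A ≠ ∞) (h : ∀ᶠ ε in 𝓝[>] 0, N ε ≤ A * ENNReal.ofReal (Real.exp (k * ω (1 / ε))))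
    (hk : k < k') : IsLittleOExp N ω k' := by
  have h1 : Tendsto (fun ε => A * ENNReal.ofReal (Real.exp (-((k' - k) * ω (1 / ε)))))
      (𝓝[>] 0) (𝓝 0) := by
    rw [← mul_zero A]
    refine ENNReal.Tendsto.const_mul ?_ (Or.inr hA)
    rw [← ENNReal.ofReal_zero]
    exact (ENNReal.continuous_ofReal.tendsto 0).comp (Real.tendsto_exp_neg_atTop_nhds_zero.comp
      (hω.tendsto_inv.const_mul_atTop (sub_pos.2 hk)))
  refine tendsto_of_tendsto_of_tendsto_of_le_of_le' tendsto_const_nhds h1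
    (Eventually.of_forall fun _ => zero_le) ?_
  filter_upwards [h] with ε hε
  calc _ ≤ A * ENNReal.ofReal (Real.exp (k * ω (1 / ε))) *
        ENNReal.ofReal (Real.exp (-(k' * ω (1 / ε)))) := by gcongr
    _ = _ := by
      rw [mul_assoc, ← ENNReal.ofReal_mul (Real.exp_pos _).le, ← Real.exp_add]
      ring_nf

/-- The local norms of a moderate net are eventually finite, which provides cutoff functions. -/
lemma RoumieuModerate.exists_cutoff {g : Net d} (hg : g ∈ RoumieuModerate ω Ω)
    {K : Set (Eucl d)} (hK : IsCompact K) (hKΩ : K ⊆ Ω) :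
    ∃ χ ∈ RoumieuTest ω Ω, ∀ x ∈ K, χ x = 1 := by
  obtain ⟨l, -, h⟩ := hg.2 K hK hKΩ 1 one_pos
  obtain ⟨ε, hε⟩ := h.eventually_le.exists
  have h1 := hε.trans_lt ENNReal.ofReal_lt_top
  -- Without admissible cutoffs the infimum would be `∞`.
  simp only [localNorm, iInf_lt_iff] at h1
  obtain ⟨χ, hχ, -⟩ := h1
  exact ⟨χ, hχ.1, hχ.2⟩

/-- The two local norms may be nearly attained at different cutoffs. Fixing one `χ` and passing to
the larger compact set `tsupport χ` lets the triangle inequality act on `χ g` and `χ g'`. -/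
lemma RoumieuNegligible.sub (hω : IsWeight ω)
    (hcut : ∀ K : Set (Eucl d), IsCompact K → K ⊆ Ω →
      ∃ χ ∈ RoumieuTest ω Ω, ∀ x ∈ K, χ x = 1) {g g' : Net d}
    (hg : g ∈ RoumieuNegligible ω Ω) (hg' : g' ∈ RoumieuNegligible ω Ω) :
    g - g' ∈ RoumieuNegligible ω Ω := by
  refine ⟨fun ε hε => RoumieuSmooth.sub hω (hg.1 ε hε) (hg'.1 ε hε), fun K hK hKΩ => ?_⟩
  obtain ⟨χ, hχ, hχK⟩ := hcut K hK hKΩ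
  obtain ⟨l₀, hl₀, hχl⟩ := hχ.2.2.2
  obtain ⟨k₁, hk₁, l₁, hl₁, h₁⟩ := hg.2 _ hχ.2.1 hχ.2.2.1
  obtain ⟨k₂, hk₂, l₂, hl₂, h₂⟩ := hg'.2 _ hχ.2.1 hχ.2.2.1
  set l := min l₀ (min l₁ l₂)
  have hl : 0 < l := lt_min hl₀ (lt_min hl₁ hl₂)
  have hll₁ : l ≤ l₁ := (min_le_right _ _).trans (min_le_left _ _)
  have hll₂ : l ≤ l₂ := (min_le_right _ _).trans (min_le_right _ _)
  refine ⟨min k₁ k₂, lt_min hk₁ hk₂, l, hl, ?_⟩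
  have h₁' := h₁.mono hω (N' := fun ε => localNorm ω Ω (tsupport χ) l (g ε))
    (Eventually.of_forall fun ε => localNorm_mono hω hll₁ _ _)
    (neg_le_neg (min_le_left k₁ k₂))
  have h₂' := h₂.mono hω (N' := fun ε => localNorm ω Ω (tsupport χ) l (g' ε))
    (Eventually.of_forall fun ε => localNorm_mono hω hll₂ _ _)
    (neg_le_neg (min_le_right k₁ k₂))
  have hA : weightNorm ω l χ + 1 ≠ ∞ := by
    simpa using ((weightNorm_mono hω (min_le_left _ _) χ).trans_lt hχl).ne
  refine ((h₁'.add h₂').const_mul hA).mono hω ?_ le_rfl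
  filter_upwards [Ioo_mem_nhdsGT (zero_lt_one' ℝ)] with ε hε
  refine (localNorm_le_weightNorm hχ hχK l _).trans ?_
  rw [Pi.sub_apply, mul_sub, mul_add]
  refine (weightNorm_sub_le (RoumieuTest.integrable ((hg.1 ε hε).2 χ hχ))
    (RoumieuTest.integrable ((hg'.1 ε hε).2 χ hχ)) l hω).trans ?_
  gcongr
  · exact weightNorm_mul_le_localNorm hω hl.le hχ (hg.1 ε hε) (by simp) hA le_self_add
  · exact weightNorm_mul_le_localNorm hω hl.le hχ (hg'.1 ε hε) (by simp) hA le_self_add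

/-- A Roumieu test function for `ω`, multiplied by the Fourier transform of a function that decays
faster than every `exp (-l ω₁)`, is a Beurling test function for the smaller weight `ω₁`. -/
lemma mul_fourier_mem_BeurlingTest {ω₁ : ℝ → ℝ} (h₁ : IsWeight ω₁) (hω : IsWeight ω)
    (hlt : WeightLT ω₁ ω) {χ u : Eucl d → ℂ} (hχ : χ ∈ RoumieuTest ω Ω)
    (hu : ∀ l : ℝ, 0 < l → Integrable fun ξ => Real.exp (l * ω₁ ‖ξ‖) * ‖u ξ‖)
    (hum : AEStronglyMeasurable u) : χ * 𝓕 u ∈ BeurlingTest ω₁ Ω := by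
  have hpow : ∀ n : ℕ, Integrable (fun ξ => ‖ξ‖ ^ n * ‖u ξ‖) := by
    intro n
    obtain ⟨C, hC⟩ := h₁.exists_norm_pow_le (d := d) n
    refine ((hu 1 one_pos).const_mul (Real.exp C)).mono'
      ((continuous_norm.pow n).aestronglyMeasurable.mul hum.norm) (ae_of_all _ fun ξ => ?_)
    rw [Real.norm_of_nonneg (by positivity), ← mul_assoc, one_mul]
    gcongr
    exact hC ξ
  have hui : Integrable u := (integrable_norm_iff hum).1 (by simpa using hpow 0)
  refine ⟨hχ.1.mul (Real.contDiff_fourier fun n _ => hpow n), hχ.2.1.mul_right,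
    (tsupport_mul_subset_left).trans hχ.2.2.1, fun l hl => ?_⟩
  refine (weightNorm_mul_fourier_le h₁ hl.le (RoumieuTest.integrable hχ) hui).trans_lt
    (ENNReal.mul_lt_top ?_ ?_)
  · obtain ⟨l₀, hl₀, hfin⟩ := hχ.2.2.2
    -- The single order `l₀` available for `ω` controls every order `l` for the smaller weight.
    obtain ⟨C, hC⟩ := h₁.exists_mul_le_mul hω hlt hl.le hl₀
    refine lt_of_le_of_lt (b := ENNReal.ofReal (Real.exp C) * weightNorm ω l₀ χ) ?_
      (ENNReal.mul_lt_top ENNReal.ofReal_lt_top hfin)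
    rw [weightNorm, weightNorm, ← lintegral_const_mul' _ _ ENNReal.ofReal_ne_top]
    refine lintegral_mono fun ξ => ?_
    dsimp only
    rw [mul_left_comm, ← ENNReal.ofReal_mul (Real.exp_pos _).le, ← Real.exp_add]
    gcongr
    linarith [hC _ (norm_nonneg ξ)]
  · refine lt_of_eq_of_lt (lintegral_congr fun ξ => ?_) (hu l hl).2
    rw [enorm_mul, enorm_norm, mul_comm, Real.enorm_of_nonneg (Real.exp_pos _).le]

end TestFunctions

/-! ### Uniformity by the Baire category theorem -/

/-- A family of functionals that decays exponentially at each vector decays exponentially in the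
dual norm, with one rate. -/
lemma exists_uniform_exp_decay {X : Type*} [NormedAddCommGroup X] [NormedSpace ℂ X]
    [CompleteSpace X] {w : ℝ → ℝ} {a : ℝ} (ha : 0 < a) (hw : ∀ ε ∈ Ioo 0 a, 0 ≤ w ε)
    {T : ℝ → X →L[ℂ] ℂ}
    (hT : ∀ x, ∃ m : ℝ, 0 < m ∧ ∀ᶠ ε in 𝓝[>] 0, ‖T ε x‖ ≤ Real.exp (-m * w ε)) :
    ∃ m : ℝ, 0 < m ∧ ∃ C : ℝ, ∀ᶠ ε in 𝓝[>] 0, ∀ x, ‖T ε x‖ ≤ C * Real.exp (-m * w ε) * ‖x‖ := by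
  let δ : ℕ → ℝ := fun n => 1 / ((n : ℝ) + 1)
  have hδ : ∀ n, 0 < δ n := fun n => Nat.one_div_pos_of_nat
  have hδm : ∀ b : ℝ, 0 < b → ∀ᶠ n in atTop, δ n < b := fun b hb =>
    tendsto_one_div_add_atTop_nhds_zero_nat.eventually_lt_const hb
  -- `δ n` serves both as decay rate and as threshold for `ε`, so countably many closed sets cover
  -- `X`.
  let F : ℕ → Set X := fun n => {x | ∀ ε ∈ Ioo 0 (δ n), ‖T ε x‖ ≤ Real.exp (-δ n * w ε)}
  have hF : ∀ n, IsClosed (F n) := by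
    intro n
    simp only [F, ofPred_forall]
    exact isClosed_iInter fun ε => isClosed_iInter fun _ =>
      isClosed_le (T ε).continuous.norm continuous_const
  have hU : ⋃ n, F n = univ := by
    refine eq_univ_of_forall fun x => ?_
    obtain ⟨m, hm, h⟩ := hT x
    obtain ⟨b, hb, h⟩ := mem_nhdsGT_iff_exists_Ioo_subset.1 h
    obtain ⟨n, hn1, hn2, hn3⟩ := ((hδm m hm).and ((hδm b hb).and (hδm a ha))).exists
    refine mem_iUnion.2 ⟨n, fun ε hε => ?_⟩
    have h1 : ‖T ε x‖ ≤ Real.exp (-m * w ε) := h ⟨hε.1, hε.2.trans hn2⟩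
    have h2 := hw ε ⟨hε.1, hε.2.trans hn3⟩
    refine h1.trans ?_
    gcongr
  obtain ⟨n, x₀, hx₀⟩ := nonempty_interior_of_iUnion_of_closed hF hU
  obtain ⟨r, hr, hball⟩ := Metric.nhds_basis_closedBall.mem_iff.1 (mem_interior_iff_mem_nhds.1 hx₀)
  refine ⟨δ n, hδ n, 2 / r, ?_⟩
  filter_upwards [Ioo_mem_nhdsGT (hδ n)] with ε hε x
  have hx₀F : ‖T ε x₀‖ ≤ Real.exp (-δ n * w ε) :=
    hball (Metric.mem_closedBall_self hr.le) ε hε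
  have := LinearMap.bound_of_ball_bound' hr (2 * Real.exp (-δ n * w ε)) (T ε).toLinearMap
    (fun z hz => ?_) x
  · refine this.trans_eq ?_
    ring
  · have h1 : ‖T ε (x₀ + z)‖ ≤ Real.exp (-δ n * w ε) :=
      hball (by simpa using hz) ε hε
    have h2 : T ε z = T ε (x₀ + z) - T ε x₀ := by simp
    change ‖T ε z‖ ≤ _
    rw [h2]
    linarith [norm_sub_le (T ε (x₀ + z)) (T ε x₀)]

/-- Integration against a bounded measurable function, as a functional on `L¹`. -/
lemma exists_clm_L1 {α : Type*} [MeasurableSpace α] {μ : Measure α} {G : α → ℂ}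
    (hG : AEStronglyMeasurable G μ) {c : ℝ} (hc : ∀ x, ‖G x‖ ≤ c) :
    ∃ T : Lp ℂ 1 μ →L[ℂ] ℂ, ∀ v : Lp ℂ 1 μ, T v = ∫ x, G x * v x ∂μ := by
  have hi : ∀ v : Lp ℂ 1 μ, Integrable (fun x => G x * v x) μ := fun v =>
    (L1.integrable_coeFn v).bdd_mul hG (ae_of_all _ hc)
  refine ⟨LinearMap.mkContinuous
    { toFun := fun v => ∫ x, G x * v x ∂μ
      map_add' := fun v v' => ?_
      map_smul' := fun z v => ?_ } c fun v => ?_, fun v => rfl⟩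
  · rw [← integral_add (hi v) (hi v')]
    refine integral_congr_ae ?_
    filter_upwards [Lp.coeFn_add v v'] with x hx
    rw [hx, Pi.add_apply, mul_add]
  · rw [RingHom.id_apply, ← integral_smul]
    refine integral_congr_ae ?_
    filter_upwards [Lp.coeFn_smul z v] with x hx
    simp only [hx, Pi.smul_apply, smul_eq_mul]
    ring
  · change ‖∫ x, G x * v x ∂μ‖ ≤ _
    rw [L1.norm_eq_integral_norm, ← integral_const_mul]
    refine norm_integral_le_of_norm_le ((L1.integrable_coeFn v).norm.const_mul c)
      (ae_of_all _ fun x => ?_)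
    rw [norm_mul]
    gcongr
    exact hc x

/-! ### Regularity of nets with negligible pairings -/

section Main

variable {d : ℕ} {ω ω₁ : ℝ → ℝ} {Ω : Set (Eucl d)}

lemma norm_fourier_le_integral_norm (f : Eucl d → ℂ) (ξ : Eucl d) : ‖𝓕 f ξ‖ ≤ ∫ x, ‖f x‖ :=
  VectorFourier.norm_fourierIntegral_le_integral_norm _ _ _ f ξ

/-- An `L¹` function, damped by the geometric mean of the two weights, has a Fourier transform
whose product with a test function is a Beurling test function. -/
lemma mul_fourier_damped_mem_BeurlingTest (h₁ : IsWeight ω₁) (hω : IsWeight ω)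
    (hlt : WeightLT ω₁ ω) {χ v : Eucl d → ℂ} (hχ : χ ∈ RoumieuTest ω Ω) (hv : Integrable v) :
    χ * 𝓕 (fun ξ => (Real.exp (-√(ω₁ ‖ξ‖ * ω ‖ξ‖)) : ℂ) * v ξ) ∈ BeurlingTest ω₁ Ω := by
  have hW : Continuous fun ξ : Eucl d => √(ω₁ ‖ξ‖ * ω ‖ξ‖) :=
    (h₁.continuous_norm.mul hω.continuous_norm).sqrt
  have hum : AEStronglyMeasurable
      (fun ξ => (Real.exp (-√(ω₁ ‖ξ‖ * ω ‖ξ‖)) : ℂ) * v ξ) :=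
    (Complex.continuous_ofReal.comp (Real.continuous_exp.comp hW.neg)).aestronglyMeasurable.mul
      hv.1
  refine mul_fourier_mem_BeurlingTest h₁ hω hlt hχ (fun l hl => ?_) hum
  obtain ⟨C, hC⟩ := h₁.exists_mul_le_sqrt hω hlt hl.le
  refine (hv.norm.const_mul (Real.exp C)).mono'
    ((h₁.continuous_exp_mul_norm l).aestronglyMeasurable.mul hum.norm) (ae_of_all _ fun ξ => ?_)
  rw [Real.norm_of_nonneg (by positivity), norm_mul, Complex.norm_real,
    Real.norm_of_nonneg (Real.exp_pos _).le, ← mul_assoc, ← Real.exp_add]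
  gcongr
  linarith [hC _ (norm_nonneg ξ)]

/-- By the multiplication formula the integral is the pairing of `h ε` with a Beurling test
function; Baire on `L¹` makes its decay uniform in `v`. -/
lemma exists_uniform_fourier_decay (h₁ : IsWeight ω₁) (hω : IsWeight ω) (hlt : WeightLT ω₁ ω)
    {h : Net d} (hh : ∀ ε ∈ Ioo (0 : ℝ) 1, h ε ∈ RoumieuSmooth ω Ω)
    (hpair : ∀ ρ ∈ BeurlingTest ω₁ Ω, NegligibleConst ω (fun ε => ∫ x, h ε x * ρ x))
    {χ : Eucl d → ℂ} (hχ : χ ∈ RoumieuTest ω Ω) :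
    ∃ m : ℝ, 0 < m ∧ ∃ C : ℝ, ∀ᶠ ε in 𝓝[>] 0, ∀ v : Eucl d → ℂ, Integrable v →
      ‖∫ ξ, 𝓕 (χ * h ε) ξ * ((Real.exp (-√(ω₁ ‖ξ‖ * ω ‖ξ‖)) : ℂ) * v ξ)‖ ≤
        C * Real.exp (-m * ω (1 / ε)) * ∫ ξ, ‖v ξ‖ := by
  have hW : Continuous fun ξ : Eucl d => √(ω₁ ‖ξ‖ * ω ‖ξ‖) :=
    (h₁.continuous_norm.mul hω.continuous_norm).sqrt
  have hE : Continuous fun ξ : Eucl d => (Real.exp (-√(ω₁ ‖ξ‖ * ω ‖ξ‖)) : ℂ) :=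
    Complex.continuous_ofReal.comp (Real.continuous_exp.comp hW.neg)
  have hE1 : ∀ ξ : Eucl d, ‖(Real.exp (-√(ω₁ ‖ξ‖ * ω ‖ξ‖)) : ℂ)‖ ≤ 1 := fun ξ => by
    rw [Complex.norm_real, Real.norm_of_nonneg (Real.exp_pos _).le, Real.exp_le_one_iff]
    exact neg_nonpos.2 (Real.sqrt_nonneg _)
  -- Nothing is known about `h ε` outside `(0, 1)`, so the functional is set to zero there.
  have hT : ∀ ε : ℝ, ∃ T : Lp ℂ 1 (volume : Measure (Eucl d)) →L[ℂ] ℂ, ε ∈ Ioo (0 : ℝ) 1 →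
      ∀ v, T v = ∫ ξ, 𝓕 (χ * h ε) ξ * ((Real.exp (-√(ω₁ ‖ξ‖ * ω ‖ξ‖)) : ℂ) * v ξ) := by
    intro ε
    by_cases hε : ε ∈ Ioo (0 : ℝ) 1
    · have hf := RoumieuTest.integrable ((hh ε hε).2 χ hχ)
      obtain ⟨T, hT⟩ := exists_clm_L1 (μ := (volume : Measure (Eucl d)))
        ((continuous_fourier hf).mul hE).aestronglyMeasurable
        (c := (∫ x, ‖(χ * h ε) x‖) * 1) (fun ξ => by
          rw [Pi.mul_apply, norm_mul]
          exact mul_le_mul (norm_fourier_le_integral_norm _ ξ) (hE1 ξ) (norm_nonneg _)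
            (integral_nonneg fun _ => norm_nonneg _))
      refine ⟨T, fun _ v => ?_⟩
      simp only [hT, Pi.mul_apply, mul_assoc]
    · exact ⟨0, fun hε' => absurd hε' hε⟩
  choose T hT using hT
  have hsmall : Ioo (0 : ℝ) 1 ∈ 𝓝[>] (0 : ℝ) := Ioo_mem_nhdsGT zero_lt_one
  obtain ⟨m, hm, C, hmC⟩ := exists_uniform_exp_decay (T := T) (w := fun ε => ω (1 / ε))
    zero_lt_one (fun ε hε => hω.nonneg (one_div_nonneg.2 hε.1.le)) fun v => by
      obtain ⟨m, hm, hv⟩ := hpair _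
        (mul_fourier_damped_mem_BeurlingTest h₁ hω hlt hχ (L1.integrable_coeFn v))
      refine ⟨m, hm, ?_⟩
      filter_upwards [hv.eventually_le, hsmall] with ε h2 hε
      have hf := RoumieuTest.integrable ((hh ε hε).2 χ hχ)
      rw [hT ε hε, integral_fourier_mul_eq hf
        ((L1.integrable_coeFn v).bdd_mul hE.aestronglyMeasurable (ae_of_all _ hE1))]
      rw [← ENNReal.ofReal_le_ofReal_iff (Real.exp_pos _).le, ofReal_norm]
      refine le_of_eq_of_le ?_ h2
      congr 2
      ext x
      simp only [Pi.mul_apply]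
      ring
  refine ⟨m, hm, C, ?_⟩
  filter_upwards [hmC, hsmall] with ε h2 hε v hv
  have h3 := h2 (hv.toL1 v)
  rw [hT ε hε, L1.norm_eq_integral_norm] at h3
  have h4 : ∫ ξ, 𝓕 (χ * h ε) ξ * ((Real.exp (-√(ω₁ ‖ξ‖ * ω ‖ξ‖)) : ℂ) * hv.toL1 v ξ) =
      ∫ ξ, 𝓕 (χ * h ε) ξ * ((Real.exp (-√(ω₁ ‖ξ‖ * ω ‖ξ‖)) : ℂ) * v ξ) := by
    refine integral_congr_ae ?_
    filter_upwards [hv.coeFn_toL1] with ξ hξ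
    rw [hξ]
  have h5 : ∫ ξ, ‖hv.toL1 v ξ‖ = ∫ ξ, ‖v ξ‖ := by
    refine integral_congr_ae ?_
    filter_upwards [hv.coeFn_toL1] with ξ hξ
    rw [hξ]
  rwa [h4, h5] at h3

lemma exists_weightNorm_neg_decay (h₁ : IsWeight ω₁) (hω : IsWeight ω) (hlt : WeightLT ω₁ ω)
    {h : Net d} (hh : ∀ ε ∈ Ioo (0 : ℝ) 1, h ε ∈ RoumieuSmooth ω Ω)
    (hpair : ∀ ρ ∈ BeurlingTest ω₁ Ω, NegligibleConst ω (fun ε => ∫ x, h ε x * ρ x))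
    {χ : Eucl d → ℂ} (hχ : χ ∈ RoumieuTest ω Ω) :
    ∃ m : ℝ, 0 < m ∧ ∀ c : ℝ, 0 < c → ∃ A : ℝ≥0∞, A ≠ ∞ ∧ ∀ᶠ ε in 𝓝[>] 0,
      weightNorm ω (-c) (χ * h ε) ≤ A * ENNReal.ofReal (Real.exp (-m * ω (1 / ε))) := by
  obtain ⟨m, hm, C, hmC⟩ := exists_uniform_fourier_decay h₁ hω hlt hh hpair hχ
  refine ⟨m, hm, fun c hc => ?_⟩
  -- Half of `c ω` absorbs the geometric mean; the other half keeps `v` below integrable.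
  obtain ⟨D, hD⟩ := h₁.exists_sqrt_le_mul hω hlt (half_pos hc)
  have hW : Continuous fun ξ : Eucl d => √(ω₁ ‖ξ‖ * ω ‖ξ‖) :=
    (h₁.continuous_norm.mul hω.continuous_norm).sqrt
  have hB := (hω.integrable_exp_neg (d := d) (half_pos hc)).const_mul (Real.exp D)
  set B := ∫ ξ : Eucl d, Real.exp D * Real.exp (-(c / 2 * ω ‖ξ‖)) with hBdef
  refine ⟨ENNReal.ofReal (|C| * B), ENNReal.ofReal_ne_top, ?_⟩
  filter_upwards [hmC, Ioo_mem_nhdsGT (zero_lt_one' ℝ)] with ε h2 hε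
  have hf := RoumieuTest.integrable ((hh ε hε).2 χ hχ)
  have hFc := continuous_fourier hf
  set F := 𝓕 (χ * h ε) with hF
  -- The conjugate phase of `F` turns the integrand into `‖F‖ e^{-c ω}`. Where `F` vanishes the
  -- quotient is `0`, which is harmless.
  let v : Eucl d → ℂ := fun ξ =>
    (starRingEnd ℂ (F ξ) / (‖F ξ‖ : ℂ)) * (Real.exp (√(ω₁ ‖ξ‖ * ω ‖ξ‖) - c * ω ‖ξ‖) : ℂ)
  have hvm : Measurable v := by
    have e1 : Measurable fun ξ : Eucl d =>
        (Real.exp (√(ω₁ ‖ξ‖ * ω ‖ξ‖) - c * ω ‖ξ‖) : ℂ) :=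
      (Complex.continuous_ofReal.comp (Real.continuous_exp.comp
        (hW.sub (continuous_const.mul hω.continuous_norm)))).measurable
    have e2 : Measurable F := hFc.measurable
    exact ((Complex.continuous_conj.measurable.comp e2).div
      (Complex.measurable_ofReal.comp e2.norm)).mul e1
  have hvle : ∀ ξ, ‖v ξ‖ ≤ Real.exp D * Real.exp (-(c / 2 * ω ‖ξ‖)) := by
    intro ξ
    have e1 : ‖starRingEnd ℂ (F ξ) / (‖F ξ‖ : ℂ)‖ ≤ 1 := by
      rw [norm_div, RCLike.norm_conj, Complex.norm_real, norm_norm]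
      exact div_self_le_one _
    rw [norm_mul, Complex.norm_real, Real.norm_of_nonneg (Real.exp_pos _).le, ← Real.exp_add]
    refine (mul_le_of_le_one_left (Real.exp_pos _).le e1).trans (Real.exp_le_exp.2 ?_)
    linarith [hD _ (norm_nonneg ξ)]
  have hvi : Integrable v := hB.mono' hvm.aestronglyMeasurable (ae_of_all _ hvle)
  have hvB : ∫ ξ, ‖v ξ‖ ≤ B := integral_mono hvi.norm hB hvle
  have hpt : ∀ ξ, F ξ * ((Real.exp (-√(ω₁ ‖ξ‖ * ω ‖ξ‖)) : ℂ) * v ξ) =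
      ((‖F ξ‖ * Real.exp (-c * ω ‖ξ‖) : ℝ) : ℂ) := by
    intro ξ
    have e1 : Real.exp (-c * ω ‖ξ‖) = Real.exp (-√(ω₁ ‖ξ‖ * ω ‖ξ‖)) *
        Real.exp (√(ω₁ ‖ξ‖ * ω ‖ξ‖) - c * ω ‖ξ‖) := by
      rw [← Real.exp_add]; ring_nf
    have e2 : F ξ * (starRingEnd ℂ (F ξ) / (‖F ξ‖ : ℂ)) = ‖F ξ‖ := by
      rw [← mul_div_assoc, Complex.mul_conj']
      by_cases h0 : (‖F ξ‖ : ℂ) = 0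
      · simp [h0]
      · field_simp
    rw [e1]
    simp only [v]
    push_cast
    linear_combination (Complex.exp (-(√(ω₁ ‖ξ‖ * ω ‖ξ‖) : ℂ)) *
      Complex.exp ((√(ω₁ ‖ξ‖ * ω ‖ξ‖) : ℂ) - c * ω ‖ξ‖)) * e2
  have hint : Integrable fun ξ => ‖F ξ‖ * Real.exp (-c * ω ‖ξ‖) := by
    refine Integrable.bdd_mul (c := ∫ x, ‖(χ * h ε) x‖) ?_ hFc.norm.aestronglyMeasurable
      (ae_of_all _ fun ξ => ?_)
    · simpa using hω.integrable_exp_neg (d := d) hc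
    · rw [norm_norm]; exact norm_fourier_le_integral_norm _ ξ
  have hnn : ∀ ξ, 0 ≤ ‖F ξ‖ * Real.exp (-c * ω ‖ξ‖) := fun ξ => by positivity
  have h3 := h2 v hvi
  simp only [hpt] at h3
  rw [integral_complex_ofReal, Complex.norm_real,
    Real.norm_of_nonneg (integral_nonneg hnn)] at h3
  calc weightNorm ω (-c) (χ * h ε)
      = ∫⁻ ξ, ENNReal.ofReal (‖F ξ‖ * Real.exp (-c * ω ‖ξ‖)) := by
        refine lintegral_congr fun ξ => ?_
        rw [ENNReal.ofReal_mul (norm_nonneg _), ofReal_norm]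
    _ = ENNReal.ofReal (∫ ξ, ‖F ξ‖ * Real.exp (-c * ω ‖ξ‖)) :=
        (ofReal_integral_eq_lintegral_ofReal hint (ae_of_all _ hnn)).symm
    _ ≤ ENNReal.ofReal (|C| * B * Real.exp (-m * ω (1 / ε))) := by
        refine ENNReal.ofReal_le_ofReal (h3.trans ?_)
        calc _ ≤ |C| * Real.exp (-m * ω (1 / ε)) * B := by
              gcongr
              exact le_abs_self C
          _ = _ := by ring
    _ = _ := ENNReal.ofReal_mul (mul_nonneg (abs_nonneg _)
        (integral_nonneg fun _ => by positivity))

/-- Interpolation between a positive and a negative exponential order. -/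
lemma weightNorm_interpolate (hω : IsWeight ω) {f : Eucl d → ℂ} (hf : Integrable f)
    (a b s : ℝ) :
    weightNorm ω ((a + b) / 2) f ≤ ENNReal.ofReal (Real.exp (-s)) * weightNorm ω a f +
      ENNReal.ofReal (Real.exp s) * weightNorm ω b f := by
  have hFc := continuous_fourier hf
  rw [weightNorm, weightNorm, weightNorm, ← lintegral_const_mul' _ _ ENNReal.ofReal_ne_top,
    ← lintegral_const_mul' _ _ ENNReal.ofReal_ne_top, ← lintegral_add_left]
  · refine lintegral_mono fun ξ => ?_
    dsimp only
    rw [mul_left_comm, mul_left_comm (ENNReal.ofReal (Real.exp s)), ← mul_add,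
      ← ENNReal.ofReal_mul (Real.exp_pos _).le, ← ENNReal.ofReal_mul (Real.exp_pos _).le,
      ← Real.exp_add, ← Real.exp_add,
      ← ENNReal.ofReal_add (Real.exp_pos _).le (Real.exp_pos _).le]
    gcongr
    -- The exponent on the left is the mean of these two, hence at most the larger one.
    rcases le_total (s + b * ω ‖ξ‖) (-s + a * ω ‖ξ‖) with h | h
    · exact le_add_of_le_of_nonneg (Real.exp_le_exp.2 (by linarith)) (Real.exp_pos _).le
    · exact le_add_of_nonneg_of_le (Real.exp_pos _).le (Real.exp_le_exp.2 (by linarith))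
  · exact (hFc.enorm.measurable.mul (hω.measurable_ofReal_exp a)).const_mul _

lemma RoumieuModerate.isLittleOExp_weightNorm (h₁ : IsWeight ω₁) (hω : IsWeight ω)
    (hlt : WeightLT ω₁ ω) {h : Net d} (hmod : h ∈ RoumieuModerate ω Ω)
    (hpair : ∀ ρ ∈ BeurlingTest ω₁ Ω, NegligibleConst ω (fun ε => ∫ x, h ε x * ρ x))
    {χ : Eucl d → ℂ} (hχ : χ ∈ RoumieuTest ω Ω) :
    ∃ k : ℝ, 0 < k ∧ ∃ l : ℝ, 0 < l ∧
      IsLittleOExp (fun ε => weightNorm ω l (χ * h ε)) ω (-k) := by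
  obtain ⟨m, hm, hdec⟩ := exists_weightNorm_neg_decay h₁ hω hlt hmod.1 hpair hχ
  obtain ⟨l₀, hl₀, hχl⟩ := hχ.2.2.2
  obtain ⟨l₁, hl₁, hmodl⟩ := hmod.2 _ hχ.2.1 hχ.2.2.1 (m / 2) (half_pos hm)
  set l := min l₀ l₁
  have hl : 0 < l := lt_min hl₀ hl₁
  obtain ⟨A, hA, hAe⟩ := hdec (l / 2) (half_pos hl)
  have hA' : weightNorm ω l χ + 1 ≠ ∞ := by
    simpa using ((weightNorm_mono hω (min_le_left _ _) χ).trans_lt hχl).ne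
  set A' := weightNorm ω l χ + 1
  -- The order is `l/4`. The estimate below decays at rate `m/4`, and the smaller rate `m/8` turns
  -- `O` into `o`.
  refine ⟨m / 8, by positivity, (l + -(l / 2)) / 2, by linarith, ?_⟩
  refine IsLittleOExp.of_eventually_le hω (A := A' + A) (ENNReal.add_ne_top.2 ⟨hA', hA⟩)
    (k := -(m / 4)) ?_ (by linarith)
  filter_upwards [hAe, hmodl.eventually_le, Ioo_mem_nhdsGT (zero_lt_one' ℝ)] with ε e1 e2 hε
  have hf := RoumieuTest.integrable ((hmod.1 ε hε).2 χ hχ)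
  have e3 : weightNorm ω l (χ * h ε) ≤
      A' * ENNReal.ofReal (Real.exp (m / 2 * ω (1 / ε))) := by
    refine (weightNorm_mul_le_localNorm hω hl.le hχ (hmod.1 ε hε) (by simp [A']) hA'
      le_self_add).trans ?_
    gcongr
    exact (localNorm_mono hω (min_le_right _ _) _ _).trans e2
  -- The factor `3m/4` balances the two terms: `-3m/4 + m/2 = 3m/4 - m = -m/4`.
  refine (weightNorm_interpolate hω hf l (-(l / 2)) (3 * m / 4 * ω (1 / ε))).trans ?_
  rw [add_mul]
  refine add_le_add ((mul_le_mul_right e3 _).trans_eq ?_)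
    ((mul_le_mul_right e1 _).trans_eq ?_)
  all_goals
    rw [mul_left_comm, ← ENNReal.ofReal_mul (Real.exp_pos _).le, ← Real.exp_add]
    ring_nf

lemma RoumieuModerate.mem_RoumieuNegligible (h₁ : IsWeight ω₁) (hω : IsWeight ω)
    (hlt : WeightLT ω₁ ω) {h : Net d} (hmod : h ∈ RoumieuModerate ω Ω)
    (hpair : ∀ ρ ∈ BeurlingTest ω₁ Ω, NegligibleConst ω (fun ε => ∫ x, h ε x * ρ x)) :
    h ∈ RoumieuNegligible ω Ω := by
  refine ⟨hmod.1, fun K hK hKΩ => ?_⟩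
  obtain ⟨χ, hχ, hχK⟩ := RoumieuModerate.exists_cutoff hmod hK hKΩ
  obtain ⟨k, hk, l, hl, hkl⟩ :=
    RoumieuModerate.isLittleOExp_weightNorm h₁ hω hlt hmod hpair hχ
  exact ⟨k, hk, l, hl, hkl.mono hω
    (Eventually.of_forall fun ε => localNorm_le_weightNorm hχ hχK l (h ε)) le_rfl⟩

end Main

theorem mainTheorem9 {d : ℕ} (Ω : Set (Eucl d)) (hΩ : IsOpen Ω) (ω : ℝ → ℝ) (hω : IsWeight ω)
    (H : Set (Net d)) (hH : H ∈ RoumieuG ω Ω)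
    (h : Net d) (hmod : h ∈ RoumieuModerate ω Ω) (hrep : H = roumieuClass ω Ω h)
    (hpair : ∃ ω₁ : ℝ → ℝ, IsWeight ω₁ ∧ WeightLT ω₁ ω ∧
      ∀ ρ ∈ BeurlingTest ω₁ Ω, NegligibleConst ω (fun ε => ∫ x, h ε x * ρ x)) :
    H = roumieuClass ω Ω 0 ∧ h ∈ RoumieuNegligible ω Ω := by
  obtain ⟨ω₁, h₁, hlt, hpair⟩ := hpair
  have hneg := RoumieuModerate.mem_RoumieuNegligible h₁ hω hlt hmod hpair
  have hcut : ∀ K : Set (Eucl d), IsCompact K → K ⊆ Ω →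
      ∃ χ ∈ RoumieuTest ω Ω, ∀ x ∈ K, χ x = 1 :=
    fun K hK hKΩ => RoumieuModerate.exists_cutoff hmod hK hKΩ
  refine ⟨?_, hneg⟩
  subst hrep
  ext g
  refine and_congr_right fun hg => ?_
  rw [sub_zero]
  refine ⟨fun hgh => ?_, fun hg' => RoumieuNegligible.sub hω hcut hg' hneg⟩
  -- Closure under differences suffices: `0` is `h - h`, and then `g = (g - h) - (0 - h)`.
  have hzero : (0 : Net d) - h ∈ RoumieuNegligible ω Ω := by
    rw [← sub_self h]
    exact RoumieuNegligible.sub hω hcut (RoumieuNegligible.sub hω hcut hneg hneg) hneg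
  have := RoumieuNegligible.sub hω hcut hgh hzero
  rwa [zero_sub, sub_neg_eq_add, sub_add_cancel] at this
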